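/- Let $A\in\mathbb{R}^{n\times d}$ have rank $t$, and for $1\le i\le t$ let $\lambda_i$ be the $i$-th largest eigenvalue, counted with multiplicity, of $A^{\rm T}A$. Assume that $\lambda_t<\lambda_1$ (so $t\ge 2$), and let $\alpha,\beta$ be the real numbers with $$\alpha^{-1}=\frac1t\sum_{i=1}^t\lambda_i^{-1},\qquad \beta=\frac{\lambda_t^{-1}-\alpha^{-1}}{\lambda_t^{-1}-\lambda_1^{-1}}.$$ Then $0<\beta<1$, and for every integer $k$ with $\beta t\le k<t$ the number $$\gamma_{A,k}=\left(\sqrt{\frac kt}-\sqrt{\frac{\beta}{1-\beta}\left(1-\frac kt\right)}\right)^2$$ lies in $[0,1)$, and there is a subset $S\subset\{1,\dots,d\}$ of size $k$ such that $\operatorname{rank}(A_S)=k$ and $$\|A-A_SA_S^{\dagger}A\|_2^2\le\frac{1}{1+(\|A\|_2^2\,\alpha^{-1}-1)\,\gamma_{A,k}}\cdot\|A\|_2^2 .$$ Here $A_S$ is the $n\times k$ submatrix of $A$ formed by the columns indexed by $S$, $A_S^{\dagger}$ is its Moore–Penrose pseudoinverse, and $\|\cdot\|_2$ is the spectral norm.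 -/

import Mathlib

open scoped Matrix
-- From here on the norm of a matrix is its spectral norm (the operator norm between Euclidean spaces).
open scoped Matrix.Norms.L2Operator

namespace ColumnSubset

/-- The four Penrose equations: `X` is a Moore-Penrose pseudoinverse of the real matrix `A`. -/
structure IsMoorePenrose {m n : Type*} [Fintype m] [Fintype n]
    (A : Matrix m n ℝ) (X : Matrix n m ℝ) : Prop where
  mul_mul_self : A * X * A = A
  self_mul_mul : X * A * X = X
  isSymm_left : (A * X)ᵀ = A * X
  isSymm_right : (X * A)ᵀ = X * A

theorem IsMoorePenrose.unique {m n : Type*} [Fintype m] [Fintype n]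
    {A : Matrix m n ℝ} {X Y : Matrix n m ℝ}
    (hX : IsMoorePenrose A X) (hY : IsMoorePenrose A Y) : X = Y := by
  have h1 : A * X = A * Y := by
    calc A * X = (A * X)ᵀ := hX.isSymm_left.symm
      _ = ((A * Y) * (A * X))ᵀ := by
          rw [← Matrix.mul_assoc, hY.mul_mul_self]
      _ = (A * X)ᵀ * (A * Y)ᵀ := Matrix.transpose_mul _ _
      _ = A * X * (A * Y) := by rw [hX.isSymm_left, hY.isSymm_left]
      _ = A * Y := by rw [← Matrix.mul_assoc, hX.mul_mul_self]
  have h2 : X * A = Y * A := by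
    calc X * A = (X * A)ᵀ := hX.isSymm_right.symm
      _ = ((X * A) * (Y * A))ᵀ := by
          rw [Matrix.mul_assoc X A (Y * A), ← Matrix.mul_assoc A Y A, hY.mul_mul_self]
      _ = (Y * A)ᵀ * (X * A)ᵀ := Matrix.transpose_mul _ _
      _ = Y * A * (X * A) := by rw [hX.isSymm_right, hY.isSymm_right]
      _ = Y * A := by rw [Matrix.mul_assoc Y A (X * A), ← Matrix.mul_assoc A X A, hX.mul_mul_self]
  calc X = X * A * X := hX.self_mul_mul.symm
    _ = Y * (A * X) := by rw [h2, Matrix.mul_assoc]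
    _ = Y * A * Y := by rw [h1, Matrix.mul_assoc]
    _ = Y := hY.self_mul_mul

theorem exists_isMoorePenrose {m n : Type*} [Fintype m] [Fintype n]
    (A : Matrix m n ℝ) : ∃ X : Matrix n m ℝ, IsMoorePenrose A X := by
  classical
  have hG : (Aᵀ * A).IsHermitian := by
    simpa using Matrix.isHermitian_conjTranspose_mul_self A
  obtain ⟨U, D, hU, hS⟩ : ∃ (U : Matrix n n ℝ) (D : n → ℝ), Uᵀ * U = 1 ∧
      Aᵀ * A = U * Matrix.diagonal D * Uᵀ := by
    refine ⟨hG.eigenvectorUnitary, hG.eigenvalues, ?_, ?_⟩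
    · simpa [Matrix.star_eq_conjTranspose] using Unitary.coe_star_mul_self hG.eigenvectorUnitary
    · simpa [Matrix.star_eq_conjTranspose, Unitary.conjStarAlgAut_apply, Function.comp_def]
        using hG.spectral_theorem
  have key : ∀ D₁ D₂ : n → ℝ, (U * Matrix.diagonal D₁ * Uᵀ) * (U * Matrix.diagonal D₂ * Uᵀ) =
      U * Matrix.diagonal (fun i => D₁ i * D₂ i) * Uᵀ := by
    intro D₁ D₂
    calc _ = U * Matrix.diagonal D₁ * (Uᵀ * U) * Matrix.diagonal D₂ * Uᵀ := by
          simp only [Matrix.mul_assoc]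
      _ = _ := by rw [hU, Matrix.mul_one, Matrix.mul_assoc U, Matrix.diagonal_mul_diagonal]
  have hT : ∀ D₁ : n → ℝ, (U * Matrix.diagonal D₁ * Uᵀ)ᵀ = U * Matrix.diagonal D₁ * Uᵀ := by
    intro D₁
    simp [Matrix.transpose_mul, Matrix.mul_assoc]
  set B := U * Matrix.diagonal (fun i => (D i)⁻¹) * Uᵀ with hB
  have hBt : Bᵀ = B := hT _
  have hBG : B * (Aᵀ * A) = U * Matrix.diagonal (fun i => (D i)⁻¹ * D i) * Uᵀ := by
    rw [hS, key]
  have hGBG : Aᵀ * A * (B * (Aᵀ * A)) = Aᵀ * A := by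
    rw [hBG]
    conv_lhs => rw [hS]
    rw [key, hS]
    congr 3
    ext i
    by_cases h : D i = 0 <;> simp [h]
  have hBGB : B * (Aᵀ * A) * B = B := by
    rw [hBG, hB, key]
    congr 3
    ext i
    by_cases h : D i = 0 <;> simp [h]
  refine ⟨B * Aᵀ, ?_, ?_, ?_, ?_⟩
  · have h0 : Aᵀ * A * (B * (Aᵀ * A) - 1) = 0 := by
      rw [Matrix.mul_sub, hGBG, Matrix.mul_one, sub_self]
    have h1 : A * (B * (Aᵀ * A) - 1) = 0 := by
      have := (Matrix.conjTranspose_mul_self_mul_eq_zero A (B * (Aᵀ * A) - 1)).mp (by simpa using h0)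
      exact this
    rw [Matrix.mul_sub, Matrix.mul_one, sub_eq_zero] at h1
    simpa [Matrix.mul_assoc] using h1
  · calc B * Aᵀ * A * (B * Aᵀ) = B * (Aᵀ * A) * B * Aᵀ := by simp only [Matrix.mul_assoc]
      _ = B * Aᵀ := by rw [hBGB]
  · simp [Matrix.transpose_mul, hBt, Matrix.mul_assoc]
  · rw [Matrix.mul_assoc, hBG, hT]

/-- The Moore-Penrose pseudoinverse of a real matrix. -/
noncomputable def pinv {m n : Type*} [Fintype m] [Fintype n] (A : Matrix m n ℝ) :
    Matrix n m ℝ :=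
  (exists_isMoorePenrose A).choose

theorem pinv_isMoorePenrose {m n : Type*} [Fintype m] [Fintype n] (A : Matrix m n ℝ) :
    IsMoorePenrose A (pinv A) :=
  (exists_isMoorePenrose A).choose_spec

/-- The submatrix of `A` formed by the columns with index in `S`. -/
def columns {n d : ℕ} (A : Matrix (Fin n) (Fin d) ℝ) (S : Finset (Fin d)) :
    Matrix (Fin n) S ℝ :=
  A.submatrix id (fun j : S => (j : Fin d))

theorem isHermitian_gram {n d : ℕ} (A : Matrix (Fin n) (Fin d) ℝ) :
    (Aᵀ * A).IsHermitian := by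
  simpa using Matrix.isHermitian_conjTranspose_mul_self A

/-- For `1 ≤ i ≤ d`, the `i`-th largest eigenvalue, counted with multiplicity, of `Aᵀ * A`
(a `d × d` matrix); Mathlib's `eigenvalues₀` lists the eigenvalues in non-increasing order,
starting from index `0`. -/
noncomputable def gramEigenvalue {n d : ℕ} (A : Matrix (Fin n) (Fin d) ℝ) (i : ℕ) : ℝ :=
  if h : i - 1 < Fintype.card (Fin d) then (isHermitian_gram A).eigenvalues₀ ⟨i - 1, h⟩ else 0

end ColumnSubset

/-! Let `p(y) = det(1 - y AᵀA) = ∏ (1 - λ_i y)`. It has degree `t`, and its roots `1/λ_i` lie in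
`[1/λ_1, 1/λ_t]` with mean `1/α`. If `Q` projects onto the orthogonal complement of the chosen
columns, the squared residual norm is `‖AᵀQA‖`, which is at most `1/ρ` once `det(1 - y AᵀQA)` is
positive for `y < ρ`. The claimed bound is exactly `1/ρ` for `ρ = 1/λ_1 + (1/α - 1/λ_1) γ`.

Choosing column `i` replaces `M = AᵀQA` by the Schur complement of its `i`-th diagonal entry.
Weighted by `M i i`, the polynomials of these complements sum to `-p_M'`
(`sum_diag_mul_charpolyRev_downdate`). Their derivatives interlace those of `p_M`, so a lower bound
on the roots of the average passes to one of the summands (`exists_eval_pos_of_wronskian`,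
`exists_downdate`). By induction it is enough that the `k`-th derivative of `p` has no root below
`ρ`.

That is a barrier argument: if `-p'/p ≤ φ` at a point left of all roots, each differentiation moves
the point right by `1/φ` and keeps the bound (`barrier_derivative`). Starting from `1/λ_1 - s`,
convexity bounds `φ` through the mean of the roots alone, and the best `s` produces `γ`. -/

namespace ColumnSubset

/-! ### Real-rooted polynomials and the barrier function -/

section RealRooted

open Polynomial

/-- Rolle: differentiation loses at most one root, counted with multiplicity, and lowers a positive
degree. -/
theorem splits_derivative {p : ℝ[X]} (hp : p.Splits) : (derivative p).Splits := by
  rw [splits_iff_card_roots]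
  have h1 := card_roots_le_derivative p
  have h2 := card_roots' (derivative p)
  have h3 := hp.natDegree_eq_card_roots
  have h4 := natDegree_derivative_le p
  omega

theorem splits_iterate_derivative {p : ℝ[X]} (hp : p.Splits) (m : ℕ) :
    (derivative^[m] p).Splits := by
  induction m with
  | zero => exact hp
  | succ m ih => rw [Function.iterate_succ_apply']; exact splits_derivative ih

theorem exists_eq_C_mul_prod {p : ℝ[X]} (hp : p.Splits) :
    ∃ r : Fin p.natDegree → ℝ, p = C p.leadingCoeff * ∏ i, (X - C (r i)) := by
  have hl : p.roots.toList.length = p.natDegree := by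
    rw [Multiset.length_toList, hp.natDegree_eq_card_roots]
  refine ⟨fun i => p.roots.toList.get (Fin.cast hl.symm i), ?_⟩
  conv_lhs => rw [hp.eq_prod_roots]
  congr 1
  have ht : ∀ s : Multiset ℝ,
      (s.map fun a => X - C a).prod = (s.toList.map fun a => X - C a).prod := by
    intro s
    conv_lhs => rw [← s.coe_toList, Multiset.map_coe, Multiset.prod_coe]
  rw [ht, ← List.prod_ofFn]
  congr 1
  refine List.ext_get (by simp [hp.natDegree_eq_card_roots]) ?_
  intro i h1 h2
  simp

theorem eval_derivatives_prod {ι : Type*} (s : Finset ι) (r : ι → ℝ) (x : ℝ)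
    (hx : ∀ i ∈ s, x - r i ≠ 0) :
    (derivative (∏ i ∈ s, (X - C (r i)))).eval x =
        (∏ i ∈ s, (X - C (r i))).eval x * ∑ i ∈ s, (x - r i)⁻¹ ∧
    (derivative (derivative (∏ i ∈ s, (X - C (r i))))).eval x =
        (∏ i ∈ s, (X - C (r i))).eval x *
          ((∑ i ∈ s, (x - r i)⁻¹) ^ 2 - ∑ i ∈ s, ((x - r i)⁻¹) ^ 2) := by
  classical
  induction s using Finset.induction_on with
  | empty => simp
  | insert a s ha ih =>
    obtain ⟨h1, h2⟩ := ih fun i hi => hx i (Finset.mem_insert_of_mem hi)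
    have hxa := hx a (Finset.mem_insert_self a s)
    simp only [Finset.prod_insert ha, Finset.sum_insert ha]
    simp only [derivative_mul, derivative_add, eval_mul, eval_add, derivative_sub, derivative_X,
      derivative_C, sub_zero, one_mul, eval_sub, eval_X, eval_C, h1, h2]
    constructor
    · field_simp
    · field_simp
      ring

theorem eval_derivatives_of_splits {p : ℝ[X]} (hp : p.Splits) :
    ∃ r : Fin p.natDegree → ℝ, (∀ x, p.eval x = p.leadingCoeff * ∏ i, (x - r i)) ∧
      ∀ x, p.eval x ≠ 0 →
        (derivative p).eval x = p.eval x * ∑ i, (x - r i)⁻¹ ∧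
        (derivative (derivative p)).eval x =
          p.eval x * ((∑ i, (x - r i)⁻¹) ^ 2 - ∑ i, ((x - r i)⁻¹) ^ 2) := by
  obtain ⟨r, hr⟩ := exists_eq_C_mul_prod hp
  have he : ∀ x, p.eval x = p.leadingCoeff * ∏ i, (x - r i) := by
    intro x
    conv_lhs => rw [hr]
    simp [eval_prod]
  refine ⟨r, he, fun x hx => ?_⟩
  have hne : ∀ i ∈ Finset.univ, x - r i ≠ 0 := by
    rw [he] at hx
    exact Finset.prod_ne_zero_iff.mp (right_ne_zero_of_mul hx)
  obtain ⟨h1, h2⟩ := eval_derivatives_prod Finset.univ r x hne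
  generalize hc : p.leadingCoeff = c at hr
  generalize (∏ i, (X - C (r i))) = q at *
  subst hr
  simp only [derivative_C_mul, eval_C_mul, h1, h2]
  constructor <;> ring

/-- The Laguerre inequality for real-rooted polynomials. -/
theorem eval_mul_derivative_derivative_le {p : ℝ[X]} (hp : p.Splits) (x : ℝ) :
    p.eval x * (derivative (derivative p)).eval x ≤ (derivative p).eval x ^ 2 := by
  obtain ⟨r, -, h⟩ := eval_derivatives_of_splits hp
  by_cases hx : p.eval x = 0
  · rw [hx, zero_mul]; positivity
  · obtain ⟨h1, h2⟩ := h x hx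
    rw [h1, h2]
    have : 0 ≤ p.eval x ^ 2 * ∑ i, ((x - r i)⁻¹) ^ 2 := by positivity
    nlinarith

/-- A weighted Chebyshev sum inequality. -/
theorem sum_mul_sum_le_of_antivary {ι : Type*} (s : Finset ι) (w a c : ι → ℝ)
    (hw : ∀ i ∈ s, 0 ≤ w i) (h : ∀ i ∈ s, ∀ j ∈ s, (a i - a j) * (c i - c j) ≤ 0) :
    (∑ i ∈ s, w i * a i * c i) * ∑ i ∈ s, w i ≤
      (∑ i ∈ s, w i * a i) * ∑ i ∈ s, w i * c i := by
  have key : ∑ i ∈ s, ∑ j ∈ s, w i * w j * ((a i - a j) * (c i - c j)) ≤ 0 :=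
    Finset.sum_nonpos fun i hi => Finset.sum_nonpos fun j hj =>
      mul_nonpos_of_nonneg_of_nonpos (mul_nonneg (hw i hi) (hw j hj)) (h i hi j hj)
  have e : ∑ i ∈ s, ∑ j ∈ s, w i * w j * ((a i - a j) * (c i - c j)) =
      2 * ((∑ i ∈ s, w i * a i * c i) * ∑ i ∈ s, w i) -
      2 * ((∑ i ∈ s, w i * a i) * ∑ i ∈ s, w i * c i) := by
    have e1 := Finset.sum_mul_sum s s (fun i => w i * a i * c i) w
    have e2 := Finset.sum_mul_sum s s w (fun i => w i * a i * c i)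
    have e3 := Finset.sum_mul_sum s s (fun i => w i * a i) (fun i => w i * c i)
    have e4 := Finset.sum_mul_sum s s (fun i => w i * c i) (fun i => w i * a i)
    have : ∑ i ∈ s, ∑ j ∈ s, w i * w j * ((a i - a j) * (c i - c j)) =
      ∑ i ∈ s, ∑ j ∈ s, (w i * a i * c i) * w j + ∑ i ∈ s, ∑ j ∈ s, w i * (w j * a j * c j)
      - ∑ i ∈ s, ∑ j ∈ s, (w i * a i) * (w j * c j)
      - ∑ i ∈ s, ∑ j ∈ s, (w i * c i) * (w j * a j) := by
      simp only [← Finset.sum_add_distrib, ← Finset.sum_sub_distrib]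
      refine Finset.sum_congr rfl fun i _ => Finset.sum_congr rfl fun j _ => by ring
    rw [this, ← e1, ← e2, ← e3, ← e4]
    ring
  linarith

/-- One differentiation moves the barrier point `y` to the right by `1 / φ` without increasing the
barrier function `-p' / p` above `φ`. -/
theorem barrier_derivative {p : ℝ[X]} (hp : p.Splits) (hd : 2 ≤ p.natDegree) {y φ : ℝ}
    (hpos : ∀ z ≤ y, 0 < p.eval z) (hφ : -(derivative p).eval y ≤ φ * p.eval y) :
    0 < φ ∧ (∀ z ≤ y + 1 / φ, 0 < (-derivative p).eval z) ∧
      -(derivative (-derivative p)).eval (y + 1 / φ) ≤ φ * (-derivative p).eval (y + 1 / φ) := by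
  obtain ⟨r, he, hder⟩ := eval_derivatives_of_splits hp
  have hc : p.leadingCoeff ≠ 0 := by
    intro h0
    have := he y
    rw [h0, zero_mul] at this
    exact (hpos y le_rfl).ne' this
  have hr : ∀ i, y < r i := by
    intro i
    by_contra! hi
    have := he (r i)
    rw [Finset.prod_eq_zero (Finset.mem_univ i) (sub_self _), mul_zero] at this
    exact (hpos _ hi).ne' this
  have hsum : ∑ i, (r i - y)⁻¹ ≤ φ := by
    have hy := hpos y le_rfl
    have h1 := (hder y hy.ne').1
    have h2 : ∑ i, (y - r i)⁻¹ = - ∑ i, (r i - y)⁻¹ := by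
      rw [← Finset.sum_neg_distrib]
      refine Finset.sum_congr rfl fun i _ => ?_
      rw [← inv_neg, neg_sub]
    rw [h1, h2] at hφ
    refine le_of_mul_le_mul_left ?_ hy
    linarith
  have hpos' : ∀ i, 0 < (r i - y)⁻¹ := fun i => inv_pos.mpr (sub_pos.mpr (hr i))
  -- Degree at least two leaves another positive term in the sum, so the inequality is strict and
  -- every root lies beyond `y + 1 / φ`.
  have hlt : ∀ i, (r i - y)⁻¹ < φ := by
    intro i
    refine lt_of_lt_of_le ?_ hsum
    obtain ⟨j, hj⟩ : ∃ j : Fin p.natDegree, j ≠ i :=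
      haveI : Nontrivial (Fin p.natDegree) := Fin.nontrivial_iff_two_le.mpr hd
      exists_ne i
    exact Finset.single_lt_sum hj (Finset.mem_univ i) (Finset.mem_univ j) (hpos' j)
      fun k _ _ => (hpos' k).le
  have hφ0 : 0 < φ := (hpos' ⟨0, by omega⟩).trans (hlt _)
  have hrx : ∀ i, y + 1 / φ < r i := by
    intro i
    have := (inv_lt_comm₀ (sub_pos.mpr (hr i)) hφ0).mp (hlt i)
    rw [one_div]; linarith
  have hpx : ∀ z ≤ y + 1 / φ, 0 < p.eval z := by
    intro z hz
    by_cases hzy : z ≤ y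
    · exact hpos z hzy
    · have hy := hpos y le_rfl
      rw [he] at hy ⊢
      -- The sign of the constant in front is read off at `y`, where all `r i - y` are positive.
      have e : ∀ w, p.leadingCoeff * ∏ i, (w - r i) =
          (p.leadingCoeff * ∏ i : Fin p.natDegree, (-1 : ℝ)) * ∏ i, (r i - w) := by
        intro w
        rw [mul_assoc, ← Finset.prod_mul_distrib]
        congr 1
        exact Finset.prod_congr rfl fun i _ => by ring
      rw [e] at hy ⊢
      have h1 : 0 < ∏ i, (r i - y) := Finset.prod_pos fun i _ => sub_pos.mpr (hr i)
      have h2 : 0 < ∏ i, (r i - z) := Finset.prod_pos fun i _ => by linarith [hrx i]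
      exact mul_pos (pos_of_mul_pos_left hy h1.le) h2
  refine ⟨hφ0, ?_, ?_⟩
  · intro z hz
    have h0 := hpx z hz
    rw [eval_neg, (hder z h0.ne').1, ← mul_neg, ← Finset.sum_neg_distrib]
    refine mul_pos h0 (Finset.sum_pos (fun i _ => ?_) ⟨⟨0, by omega⟩, Finset.mem_univ _⟩)
    rw [← inv_neg, neg_sub]
    exact inv_pos.mpr (by linarith [hrx i])
  · set x := y + 1 / φ with hx
    have h0 := hpx x le_rfl
    obtain ⟨h1, h2⟩ := hder x h0.ne'
    simp only [derivative_neg, eval_neg, h1, h2, neg_neg]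
    set a : Fin p.natDegree → ℝ := fun i => (r i - x)⁻¹ with ha
    have hapos : ∀ i, 0 < a i := fun i => inv_pos.mpr (sub_pos.mpr (hrx i))
    have e1 : ∑ i, (x - r i)⁻¹ = - ∑ i, a i := by
      rw [← Finset.sum_neg_distrib]
      refine Finset.sum_congr rfl fun i _ => ?_
      rw [ha, ← inv_neg, neg_sub]
    have e2 : ∑ i, ((x - r i)⁻¹) ^ 2 = ∑ i, a i * a i := by
      refine Finset.sum_congr rfl fun i _ => ?_
      rw [ha, ← neg_sub (r i) x, inv_neg]; ring
    rw [e1, e2]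
    have hb : ∀ i, (r i - y)⁻¹ = a i * (1 + a i / φ)⁻¹ := by
      intro i
      have h3 : r i - x ≠ 0 := (sub_pos.mpr (hrx i)).ne'
      have h4 : r i - y = (r i - x) * (1 + a i / φ) := by
        rw [mul_add, mul_one, ← mul_div_assoc, mul_inv_cancel₀ h3, hx]
        ring
      rw [h4, mul_inv]
    -- With `a i = 1 / (r i - x)`, the barrier inequality at `x` amounts to `S² - Q ≤ φ S`. As `S =
    -- B + D / φ` and `B ≤ φ`, it remains to see `D S ≤ Q φ`. Chebyshev with weights `a` gives `D S
    -- ≤ Q B`, since `(1 + a / φ)⁻¹` decreases in `a`.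
    have cheb := sum_mul_sum_le_of_antivary Finset.univ a a (fun i => (1 + a i / φ)⁻¹)
      (fun i _ => (hapos i).le) (by
        intro i _ j _
        have hi : 0 < 1 + a i / φ := by have := hapos i; positivity
        have hj : 0 < 1 + a j / φ := by have := hapos j; positivity
        rcases le_total (a i) (a j) with hij | hij
        · refine mul_nonpos_of_nonpos_of_nonneg (by linarith) (sub_nonneg.mpr ?_)
          gcongr
        · refine mul_nonpos_of_nonneg_of_nonpos (by linarith) (sub_nonpos.mpr ?_)
          gcongr)
    have hbs : ∑ i, a i * (1 + a i / φ)⁻¹ ≤ φ := by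
      simpa only [hb] using hsum
    have hsplit : ∀ i, a i = a i * (1 + a i / φ)⁻¹ + a i * a i * (1 + a i / φ)⁻¹ / φ := by
      intro i
      have hi : 1 + a i / φ ≠ 0 := by have := hapos i; positivity
      calc a i = a i * ((1 + a i / φ)⁻¹ * (1 + a i / φ)) := by rw [inv_mul_cancel₀ hi, mul_one]
        _ = _ := by ring
    have hT : ∑ i, a i = ∑ i, a i * (1 + a i / φ)⁻¹ + (∑ i, a i * a i * (1 + a i / φ)⁻¹) / φ := by
      conv_lhs => rw [Finset.sum_congr rfl fun i _ => hsplit i]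
      rw [Finset.sum_add_distrib, Finset.sum_div]
    set S := ∑ i, a i
    set Q := ∑ i, a i * a i
    set B := ∑ i, a i * (1 + a i / φ)⁻¹
    set D := ∑ i, a i * a i * (1 + a i / φ)⁻¹
    have hQ : 0 ≤ Q := Finset.sum_nonneg fun i _ => mul_self_nonneg _
    have hDS : D * S ≤ Q * φ := cheb.trans (by gcongr)
    have hD : D / φ * S ≤ Q := by
      rw [div_mul_eq_mul_div, div_le_iff₀ hφ0]; exact hDS
    have hS : 0 ≤ S := Finset.sum_nonneg fun i _ => (hapos i).le
    have : S ^ 2 - Q ≤ φ * S := by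
      have : S ^ 2 = B * S + D / φ * S := by rw [← add_mul, ← hT]; ring
      nlinarith
    nlinarith [mul_le_mul_of_nonneg_left this h0.le]

/-- The same `φ` serves at every step, so the shifts add up to `k / φ`; the degree stays at least
two before each differentiation. -/
theorem barrier_iterate_derivative {p : ℝ[X]} (hp : p.Splits) {y φ : ℝ} (k : ℕ)
    (hd : k + 1 ≤ p.natDegree)
    (hpos : ∀ z ≤ y, 0 < p.eval z) (hφ : -(derivative p).eval y ≤ φ * p.eval y) :
    ∀ z ≤ y + k / φ, 0 < (-1) ^ k * (derivative^[k] p).eval z := by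
  induction k generalizing p y with
  | zero => simpa using hpos
  | succ k ih =>
    obtain ⟨hφ0, h1, h2⟩ := barrier_derivative hp (by omega) hpos hφ
    have hdeg : (-derivative p).natDegree = p.natDegree - 1 := by
      rw [natDegree_neg]
      exact natDegree_eq_of_degree_eq_some (degree_derivative (by omega))
    have := ih (splits_derivative hp).neg (by omega) h1 h2
    intro z hz
    have h3 := this z (by push_cast at hz; rw [add_div] at hz; linarith)
    rw [iterate_derivative_neg, eval_neg] at h3
    rw [Function.iterate_succ_apply, pow_succ]
    linarith

end RealRooted

/-! ### Interlacing through Wronskians, and selection from an average -/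

section Selection

open Polynomial

theorem iterate_derivative_one_sub_mul (a : ℝ) (p : ℝ[X]) (m : ℕ) :
    derivative^[m + 1] ((1 - C a * X) * p) =
      (1 - C a * X) * derivative^[m + 1] p - C ((m + 1) * a) * derivative^[m] p := by
  induction m with
  | zero => simp [derivative_mul]; ring
  | succ m ih =>
    rw [Function.iterate_succ_apply', ih]
    simp only [derivative_sub, derivative_mul, derivative_C, derivative_X, derivative_one,
      ← Function.iterate_succ_apply' derivative]
    simp only [map_mul, map_add, map_natCast, map_one, Nat.cast_add, Nat.cast_one]
    ring

/-- By Leibniz the terms with `1 - a x` cancel, leaving `a (m (P_m² - P_{m-1} P_{m+1}) + P_m²)` with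
`P_j` the `j`-th derivative of `p`; Laguerre makes this nonnegative. -/
theorem wronskian_iterate_derivative_nonneg {p : ℝ[X]} (hp : p.Splits) {a : ℝ} (ha : 0 ≤ a)
    (m : ℕ) (x : ℝ) :
    0 ≤ (derivative^[m + 1] p).eval x * (derivative^[m] ((1 - C a * X) * p)).eval x -
      (derivative^[m] p).eval x * (derivative^[m + 1] ((1 - C a * X) * p)).eval x := by
  cases m with
  | zero =>
    rw [iterate_derivative_one_sub_mul]
    simp only [zero_add, Function.iterate_one, Function.iterate_zero_apply, eval_mul, eval_sub,
      eval_one, eval_C, eval_X, Nat.cast_zero, one_mul]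
    nlinarith [mul_nonneg ha (sq_nonneg (p.eval x))]
  | succ m =>
    have hl := eval_mul_derivative_derivative_le (splits_iterate_derivative hp m) x
    rw [iterate_derivative_one_sub_mul, iterate_derivative_one_sub_mul]
    simp only [← Function.iterate_succ_apply' derivative] at hl
    simp only [Nat.succ_eq_add_one] at hl
    simp only [eval_mul, eval_sub, eval_one, eval_C, eval_X]
    set A := eval x (derivative^[m] p)
    set B := eval x (derivative^[m + 1] p)
    set D := eval x (derivative^[m + 1 + 1] p)
    push_cast
    have : 0 ≤ a * ((m + 1) * (B ^ 2 - A * D) + B ^ 2) := by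
      have := sub_nonneg.mpr hl
      positivity
    nlinarith

theorem iterate_derivative_prod_sign {ι : Type*} (s : Finset ι) (a : ι → ℝ)
    (ha : ∀ i ∈ s, 0 ≤ a i) (m : ℕ) {y : ℝ} (hy : y ≤ 0) :
    0 ≤ (-1) ^ m * (derivative^[m] (∏ i ∈ s, (1 - C (a i) * X))).eval y := by
  classical
  induction s using Finset.induction_on generalizing m with
  | empty =>
    cases m with
    | zero => simp
    | succ m => simp
  | insert i s hi ih =>
    have ih := ih fun j hj => ha j (Finset.mem_insert_of_mem hj)
    have hai := ha i (Finset.mem_insert_self i s)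
    have h1 : 0 ≤ 1 - a i * y := by nlinarith
    rw [Finset.prod_insert hi]
    cases m with
    | zero =>
      have := ih 0
      simp only [Function.iterate_zero_apply, pow_zero, one_mul, eval_mul, eval_sub, eval_one,
        eval_C, eval_X] at this ⊢
      exact mul_nonneg h1 this
    | succ m =>
      rw [iterate_derivative_one_sub_mul]
      have h2 := mul_nonneg h1 (ih (m + 1))
      have h3 : 0 ≤ ((m : ℝ) + 1) * a i * ((-1) ^ m *
        (derivative^[m] (∏ i ∈ s, (1 - C (a i) * X))).eval y) := mul_nonneg (by positivity) (ih m)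
      simp only [eval_mul, eval_sub, eval_one, eval_C, eval_X]
      rw [pow_succ] at h2 ⊢
      linarith

theorem splits_prod_one_sub {ι : Type*} (s : Finset ι) (a : ι → ℝ) :
    (∏ i ∈ s, (1 - C (a i) * X) : ℝ[X]).Splits := by
  refine Splits.prod fun i _ => Splits.of_natDegree_le_one ?_
  refine (natDegree_sub_le _ _).trans ?_
  simp only [natDegree_one, zero_le, sup_of_le_right]
  exact (natDegree_C_mul_le _ _).trans natDegree_X_le

/-- A nonnegative combination of the products of all but one of the factors of a real-rooted
polynomial with nonnegative roots: its derivatives interlace those of the polynomial. -/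
theorem sum_prod_erase_properties {ι : Type*} [Fintype ι] [DecidableEq ι] (a c : ι → ℝ)
    (ha : ∀ i, 0 ≤ a i) (hc : ∀ i, 0 ≤ c i) (m : ℕ) :
    (∀ x, 0 ≤
      (derivative^[m + 1] (∑ l, C (c l) * ∏ i ∈ Finset.univ.erase l, (1 - C (a i) * X))).eval x *
        (derivative^[m] (∏ i, (1 - C (a i) * X))).eval x -
      (derivative^[m] (∑ l, C (c l) * ∏ i ∈ Finset.univ.erase l, (1 - C (a i) * X))).eval x *
        (derivative^[m + 1] (∏ i, (1 - C (a i) * X))).eval x) ∧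
    ∀ y ≤ 0, 0 ≤ (-1) ^ m *
      (derivative^[m] (∑ l, C (c l) * ∏ i ∈ Finset.univ.erase l, (1 - C (a i) * X))).eval y := by
  simp only [iterate_derivative_sum, iterate_derivative_C_mul, eval_finsetSum, eval_C_mul]
  constructor
  · intro x
    -- The Wronskian is linear in the combination, so each product can be treated alone.
    rw [Finset.sum_mul, Finset.sum_mul, ← Finset.sum_sub_distrib]
    refine Finset.sum_nonneg fun l _ => ?_
    have := wronskian_iterate_derivative_nonneg
      (splits_prod_one_sub (Finset.univ.erase l) a) (ha l) m x
    rw [Finset.mul_prod_erase Finset.univ (fun i => 1 - C (a i) * X) (Finset.mem_univ l)] at this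
    have := mul_nonneg (hc l) this
    linarith
  · intro y hy
    rw [Finset.mul_sum]
    refine Finset.sum_nonneg fun l _ => ?_
    have := mul_nonneg (hc l)
      (iterate_derivative_prod_sign (Finset.univ.erase l) a (fun i _ => ha i) m hy)
    linarith

theorem monotoneOn_div_of_wronskian {h q : ℝ[X]} {D : Set ℝ} (hD : Convex ℝ D)
    (hW : ∀ x, 0 ≤ (derivative q).eval x * h.eval x - q.eval x * (derivative h).eval x)
    (hne : ∀ x ∈ D, h.eval x ≠ 0) : MonotoneOn (fun x => q.eval x / h.eval x) D := by
  have hd : ∀ x ∈ D, HasDerivAt (fun x => q.eval x / h.eval x)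
      (((derivative q).eval x * h.eval x - q.eval x * (derivative h).eval x) / h.eval x ^ 2) x :=
    fun x hx => (q.hasDerivAt x).div (h.hasDerivAt x) (hne x hx)
  refine monotoneOn_of_deriv_nonneg hD
    (fun x hx => (hd x hx).continuousAt.continuousWithinAt) ?_ ?_
  · exact fun x hx => (hd x (interior_subset hx)).differentiableAt.differentiableWithinAt
  · intro x hx
    rw [(hd x (interior_subset hx)).deriv]
    exact div_nonneg (hW x) (sq_nonneg _)

/-- Since `q / h` increases, a nonpositive value of `q` forces `q ≤ 0` everywhere to its left. On
the negative half-line `q ≥ 0` as well, so `q` would have infinitely many roots. -/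
theorem eval_pos_of_wronskian {h q : ℝ[X]} {η : ℝ}
    (hW : ∀ x, 0 ≤ (derivative q).eval x * h.eval x - q.eval x * (derivative h).eval x)
    (hh : ∀ x < η, 0 < h.eval x) (hq : ∀ x ≤ 0, 0 ≤ q.eval x) (hq0 : q ≠ 0) :
    ∀ x < η, 0 < q.eval x := by
  intro y hy
  by_contra! hneg
  apply hq0
  have hmono := monotoneOn_div_of_wronskian (convex_Iio η) hW fun x hx => (hh x hx).ne'
  refine eq_zero_of_infinite_isRoot q (Set.Infinite.mono ?_ (Set.Iic_infinite (min y 0)))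
  intro z hz
  have hzy : z ≤ y := le_trans hz (min_le_left _ _)
  have h1 : q.eval z / h.eval z ≤ q.eval y / h.eval y := hmono (hzy.trans_lt hy) hy hzy
  have h2 : q.eval y / h.eval y ≤ 0 := div_nonpos_of_nonpos_of_nonneg hneg (hh y hy).le
  have h3 : q.eval z ≤ 0 := by
    have := (div_le_iff₀ (hh z (hzy.trans_lt hy))).mp (h1.trans h2)
    simpa using this
  exact le_antisymm h3 (hq z (le_trans hz (min_le_right _ _)))

/-- Past the first root `η` of `h`, an interlacing polynomial `q` that has become nonpositive stays
nonpositive as long as `h` stays negative. -/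
theorem eval_nonpos_of_wronskian {h q : ℝ[X]} {η ρ : ℝ}
    (hW : ∀ x, 0 ≤ (derivative q).eval x * h.eval x - q.eval x * (derivative h).eval x)
    (hh : ∀ x < η, 0 < h.eval x) (hη : h.eval η = 0) (hη' : (derivative h).eval η ≠ 0)
    (hh' : ∀ x, η < x → x < ρ → h.eval x < 0) (hq : ∀ x < η, 0 < q.eval x)
    {y₀ y : ℝ} (hy₀ : η ≤ y₀) (hqy₀ : q.eval y₀ ≤ 0) (hy : y₀ ≤ y) (hyρ : y < ρ) :
    q.eval y ≤ 0 := by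
  by_contra! hpos
  have hlt : y₀ < y := by
    rcases hy.lt_or_eq with h1 | h1
    · exact h1
    · subst h1; linarith
  have hηy := hy₀.trans_lt hlt
  have hhy := hh' y hηy hyρ
  have hmono := monotoneOn_div_of_wronskian (convex_Ioo η ρ) hW
    fun x hx => (hh' x hx.1 hx.2).ne
  have hmono' := monotoneOn_div_of_wronskian (convex_Iio η) hW fun x hx => (hh x hx).ne'
  set b := q.eval y / h.eval y with hb
  have hb0 : b < 0 := div_neg_of_pos_of_neg hpos hhy
  have hright : ∀ z, η < z → z ≤ y → b * h.eval z ≤ q.eval z := by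
    intro z hz hzy
    have : q.eval z / h.eval z ≤ b := hmono ⟨hz, hzy.trans_lt hyρ⟩ ⟨hηy, hyρ⟩ hzy
    rwa [div_le_iff_of_neg (hh' z hz (hzy.trans_lt hyρ))] at this
  rcases hy₀.lt_or_eq with h1 | h1
  · have h2 := hright y₀ h1 hy
    have h3 := hh' y₀ h1 (hlt.trans hyρ)
    nlinarith
  subst h1
  have hqη : q.eval η = 0 := by
    refine le_antisymm hqy₀ ?_
    have : Filter.Tendsto (fun x => q.eval x) (nhdsWithin η (Set.Iio η)) (nhds (q.eval η)) :=
      (q.continuous.tendsto η).mono_left nhdsWithin_le_nhds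
    exact ge_of_tendsto this (by
      filter_upwards [self_mem_nhdsWithin] with x hx using (hq x hx).le)
  set c := q.eval (η - 1) / h.eval (η - 1) with hc
  have hη1 : η - 1 < η := by linarith
  have hc0 : 0 < c := div_pos (hq _ hη1) (hh _ hη1)
  have hleft : ∀ z, η - 1 ≤ z → z < η → c * h.eval z ≤ q.eval z := by
    intro z hz hzη
    have : c ≤ q.eval z / h.eval z := hmono' hη1 hzη hz
    rwa [le_div_iff₀ (hh z hzη)] at this
  -- Remaining case: `q` vanishes at `η`. Then `q ≥ c h` on the left with `c > 0` and `q ≥ b h` on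
  -- the right with `b < 0`, so `q - e h` has a local minimum at `η` for each `e` in `[b, c]`. Two
  -- values of `e` contradict `h'(η) ≠ 0`.
  have hmin : ∀ e, b ≤ e → e ≤ c → (derivative q).eval η = e * (derivative h).eval η := by
    intro e hbe hec
    have hloc : IsLocalMin (fun x => q.eval x - e * h.eval x) η := by
      have hnhd : Set.Ioo (η - 1) y ∈ nhds η := Ioo_mem_nhds hη1 hlt
      filter_upwards [hnhd] with z hz
      simp only [hqη, hη, mul_zero, sub_zero]
      rcases lt_trichotomy z η with h2 | h2 | h2
      · have := hleft z hz.1.le h2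
        nlinarith [hh z h2]
      · rw [h2, hqη, hη]; simp
      · have := hright z h2 hz.2.le
        nlinarith [hh' z h2 (hz.2.trans hyρ)]
    have := hloc.hasDerivAt_eq_zero ((q.hasDerivAt η).sub ((h.hasDerivAt η).const_mul e))
    linarith
  have h2 := hmin b le_rfl (hb0.trans hc0).le
  have h3 := hmin c (hb0.trans hc0).le le_rfl
  have : (c - b) * (derivative h).eval η = 0 := by linarith
  rcases mul_eq_zero.mp this with h4 | h4
  · linarith
  · exact hη' h4

/-- `h` decreases strictly before `ρ`, so it has at most one root `η` there. If every `q i` of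
positive weight failed, each would be nonpositive from some `y i ≥ η` up to `ρ`. At the largest `y
i` all are nonpositive, whence `h' ≥ 0`, a contradiction. Without a root of `h`, a failing `q i` is
identically zero, and again `h' = 0`. -/
theorem exists_eval_pos_of_wronskian {ι : Type*} [Fintype ι] {h : ℝ[X]} {q : ι → ℝ[X]} {w : ι → ℝ}
    {ρ : ℝ} (hw : ∀ i, 0 ≤ w i)
    (hder : ∀ x, (derivative h).eval x = -∑ i, w i * (q i).eval x)
    (hW : ∀ i, 0 < w i → ∀ x,
      0 ≤ (derivative (q i)).eval x * h.eval x - (q i).eval x * (derivative h).eval x)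
    (hh : ∀ x ≤ 0, 0 ≤ h.eval x) (hq : ∀ i, 0 < w i → ∀ x ≤ 0, 0 ≤ (q i).eval x)
    (hneg : ∀ x < ρ, (derivative h).eval x < 0) :
    ∃ i, 0 < w i ∧ ∀ x < ρ, 0 < (q i).eval x := by
  have hanti : StrictAntiOn (fun x => h.eval x) (Set.Iio ρ) := by
    refine strictAntiOn_of_deriv_neg (convex_Iio ρ) h.continuous.continuousOn ?_
    intro x hx
    rw [interior_Iio] at hx
    rw [Polynomial.deriv]
    exact hneg x hx
  by_cases hroot : ∃ η < ρ, h.eval η = 0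
  · obtain ⟨η, hηρ, hη⟩ := hroot
    have hlt : ∀ x < η, 0 < h.eval x := fun x hx => by
      have := hanti (hx.trans hηρ) hηρ hx
      simpa only [hη] using this
    have hgt : ∀ x, η < x → x < ρ → h.eval x < 0 := fun x hx hxρ => by
      have := hanti hηρ hxρ hx
      simpa only [hη] using this
    by_contra! hcon
    -- The value `η` is a harmless default for zero weights and zero polynomials.
    have : ∀ i, ∃ y, η ≤ y ∧ y < ρ ∧ (0 < w i → (q i).eval y ≤ 0) := by
      intro i
      by_cases hwi : 0 < w i
      · by_cases hqi : q i = 0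
        · exact ⟨η, le_rfl, hηρ, fun _ => by simp [hqi]⟩
        · obtain ⟨y, hy, hy'⟩ := hcon i hwi
          refine ⟨y, ?_, hy, fun _ => hy'⟩
          by_contra! hyη
          exact absurd (eval_pos_of_wronskian (hW i hwi) hlt (hq i hwi) hqi y hyη) hy'.not_gt
      · exact ⟨η, le_rfl, hηρ, fun h => absurd h hwi⟩
    choose y hy hyρ hqy using this
    rcases isEmpty_or_nonempty ι with hι | hι
    · have h1 := hneg η hηρ
      rw [hder] at h1
      simp at h1
    obtain ⟨j, -, hj⟩ := Finset.exists_max_image Finset.univ y Finset.univ_nonempty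
    have h1 := hneg (y j) (hyρ j)
    rw [hder] at h1
    have h2 : ∑ i, w i * (q i).eval (y j) ≤ 0 := by
      refine Finset.sum_nonpos fun i _ => ?_
      rcases (hw i).lt_or_eq with hwi | hwi
      · refine mul_nonpos_of_nonneg_of_nonpos hwi.le ?_
        by_cases hqi : q i = 0
        · simp [hqi]
        · exact eval_nonpos_of_wronskian (hW i hwi) hlt hη (hneg η hηρ).ne hgt
            (eval_pos_of_wronskian (hW i hwi) hlt (hq i hwi) hqi) (hy i) (hqy i hwi)
            (hj i (Finset.mem_univ i)) (hyρ j)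
      · rw [← hwi, zero_mul]
    linarith
  · push Not at hroot
    have hpos : ∀ x < ρ, 0 < h.eval x := by
      intro x hx
      have h1 : min x 0 - 1 < x := by linarith [min_le_left x 0]
      have h2 : 0 ≤ h.eval (min x 0 - 1) := hh _ (by linarith [min_le_right x 0])
      by_contra! h3
      obtain ⟨z, hz, hz0⟩ := intermediate_value_Icc' h1.le h.continuous.continuousOn ⟨h3, h2⟩
      exact hroot z (hz.2.trans_lt hx) hz0
    by_contra! hcon
    have h1 := hneg (ρ - 1) (by linarith)
    rw [hder, Finset.sum_eq_zero] at h1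
    · simp at h1
    · intro i _
      rcases (hw i).lt_or_eq with hwi | hwi
      · have : q i = 0 := by
          by_contra hqi
          obtain ⟨y, hy, hy'⟩ := hcon i hwi
          exact absurd (eval_pos_of_wronskian (hW i hwi) hpos (hq i hwi) hqi y hy) hy'.not_gt
        simp [this]
      · rw [← hwi, zero_mul]

end Selection

/-! ### Characteristic polynomials of Schur complements -/

section Downdate

open Polynomial

variable {ι : Type*} [Fintype ι] [DecidableEq ι]

/-- The Schur complement of the `i`-th diagonal entry of `M`, bordered by zeros. -/
noncomputable def downdate (M : Matrix ι ι ℝ) (i : ι) : Matrix ι ι ℝ :=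
  M - (M i i)⁻¹ • Matrix.vecMulVec (M.col i) (M.col i)

theorem exists_orthogonal_diagonalization {M : Matrix ι ι ℝ} (hM : M.IsHermitian) :
    ∃ U : Matrix ι ι ℝ, Uᵀ * U = 1 ∧ M = U * Matrix.diagonal hM.eigenvalues * Uᵀ := by
  refine ⟨hM.eigenvectorUnitary, ?_, ?_⟩
  · simpa [Matrix.star_eq_conjTranspose] using Unitary.coe_star_mul_self hM.eigenvectorUnitary
  · simpa [Matrix.star_eq_conjTranspose, Unitary.conjStarAlgAut_apply, Function.comp_def]
      using hM.spectral_theorem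

theorem eval_charpolyRev_eq_det (M : Matrix ι ι ℝ) (y : ℝ) :
    M.charpolyRev.eval y = (1 - y • M).det := by
  rw [Matrix.charpolyRev, ← coe_evalRingHom, RingHom.map_det]
  congr 1
  ext i j
  rcases eq_or_ne i j with h | h
  · simp [h, mul_comm y]
  · simp [h, mul_comm y]

theorem det_orthogonal_conj {U : Matrix ι ι ℝ} (hU : Uᵀ * U = 1) (N : Matrix ι ι ℝ) :
    (U * N * Uᵀ).det = N.det := by
  have : U.det * Uᵀ.det = 1 := by
    rw [mul_comm, ← Matrix.det_mul, hU, Matrix.det_one]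
  rw [Matrix.det_mul, Matrix.det_mul]
  calc U.det * N.det * Uᵀ.det = N.det * (U.det * Uᵀ.det) := by ring
    _ = N.det := by rw [this, mul_one]

theorem charpolyRev_of_diagonalization {M U : Matrix ι ι ℝ} {a : ι → ℝ} (hU : Uᵀ * U = 1)
    (hM : M = U * Matrix.diagonal a * Uᵀ) : M.charpolyRev = ∏ l, (1 - C (a l) * X) := by
  have hU' : U * Uᵀ = 1 := mul_eq_one_comm.mp hU
  refine Polynomial.funext fun y => ?_
  have : 1 - y • M = U * Matrix.diagonal (fun l => 1 - a l * y) * Uᵀ := by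
    have : Matrix.diagonal (fun l => 1 - a l * y) = 1 - y • Matrix.diagonal a := by
      ext i j
      rcases eq_or_ne i j with h | h
      · simp [h, mul_comm]
      · simp [h]
    rw [this, Matrix.mul_sub, Matrix.sub_mul, Matrix.mul_one, hU', hM]
    simp
  rw [eval_charpolyRev_eq_det, this, det_orthogonal_conj hU, Matrix.det_diagonal, eval_prod]
  simp

theorem det_diagonal_add_vecMulVec {a : ι → ℝ} (ha : ∀ i, a i ≠ 0) (u v : ι → ℝ) :
    (Matrix.diagonal a + Matrix.vecMulVec u v).det =
      ∏ i, a i + ∑ l, u l * v l * ∏ i ∈ Finset.univ.erase l, a i := by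
  have h1 : Matrix.diagonal a + Matrix.vecMulVec u v =
      Matrix.diagonal a * (1 + Matrix.replicateCol Unit (fun i => (a i)⁻¹ * u i) *
        Matrix.replicateRow Unit v) := by
    rw [Matrix.mul_add, Matrix.mul_one]
    congr 1
    ext i j
    rw [Matrix.diagonal_mul, Matrix.mul_apply]
    simp [Matrix.vecMulVec_apply, ← mul_assoc, mul_inv_cancel₀ (ha i)]
  rw [h1, Matrix.det_mul, Matrix.det_diagonal, Matrix.det_one_add_replicateCol_mul_replicateRow,
    mul_add, mul_one, dotProduct, Finset.mul_sum]
  congr 1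
  refine Finset.sum_congr rfl fun l _ => ?_
  rw [← Finset.mul_prod_erase Finset.univ a (Finset.mem_univ l)]
  have := ha l
  field_simp

/-- In the eigenbasis the downdate is a rank-one change of a diagonal matrix, so the matrix
determinant lemma applies wherever no `1 - a l * y` vanishes, which is all but finitely many `y`.
The factor `M i i` clears the inverse, and the identity survives `M i i = 0`. -/
theorem diag_mul_charpolyRev_downdate {M U : Matrix ι ι ℝ} {a : ι → ℝ} (hU : Uᵀ * U = 1)
    (hM : M = U * Matrix.diagonal a * Uᵀ) (ha : ∀ l, 0 ≤ a l) (i : ι) :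
    C (M i i) * (downdate M i).charpolyRev =
      ∑ l, C (a l * U i l ^ 2) * ∏ j ∈ Finset.univ.erase l, (1 - C (a j) * X) := by
  have hU' : U * Uᵀ = 1 := mul_eq_one_comm.mp hU
  have hii : M i i = ∑ l, a l * U i l ^ 2 := by
    rw [hM, Matrix.mul_apply]
    refine Finset.sum_congr rfl fun l _ => ?_
    rw [Matrix.mul_diagonal, Matrix.transpose_apply]; ring
  by_cases h0 : M i i = 0
  · rw [h0, map_zero, zero_mul, eq_comm]
    refine Finset.sum_eq_zero fun l _ => ?_
    rw [hii, Finset.sum_eq_zero_iff_of_nonneg fun l _ => mul_nonneg (ha l) (sq_nonneg _)] at h0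
    rw [h0 l (Finset.mem_univ l), map_zero, zero_mul]
  have hfin : {y : ℝ | (∏ l, (1 - C (a l) * X) : ℝ[X]).IsRoot y}.Finite := by
    refine finite_setOfPred_isRoot fun h => ?_
    have := congrArg (eval 0) h
    simp [eval_prod] at this
  refine eq_of_infinite_eval_eq _ _ (hfin.infinite_compl.mono fun y hy => ?_)
  have hne : ∀ l, 1 - a l * y ≠ 0 := by
    have : eval y (∏ l, (1 - C (a l) * X) : ℝ[X]) ≠ 0 := hy
    rw [eval_prod, Finset.prod_ne_zero_iff] at this
    intro l
    simpa using this l (Finset.mem_univ l)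
  have hcol : M.col i = U *ᵥ (fun l => a l * U i l) := by
    ext j
    rw [Matrix.col_apply, hM, Matrix.mul_apply, Matrix.mulVec, dotProduct]
    refine Finset.sum_congr rfl fun l _ => ?_
    rw [Matrix.mul_diagonal, Matrix.transpose_apply]; ring
  set w : ι → ℝ := fun l => a l * U i l with hw
  have hmat : 1 - y • downdate M i = U * (Matrix.diagonal (fun l => 1 - a l * y) +
      Matrix.vecMulVec ((y / M i i) • w) w) * Uᵀ := by
    have e1 : Matrix.diagonal (fun l => 1 - a l * y) = 1 - y • Matrix.diagonal a := by
      ext i j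
      rcases eq_or_ne i j with h | h
      · simp [h, mul_comm]
      · simp [h]
    have e2 : U * Matrix.vecMulVec ((y / M i i) • w) w * Uᵀ =
        (y / M i i) • Matrix.vecMulVec (M.col i) (M.col i) := by
      rw [Matrix.mul_vecMulVec, Matrix.vecMulVec_mul, Matrix.vecMul_transpose, hcol,
        Matrix.mulVec_smul, Matrix.smul_vecMulVec]
    have e3 : U * (y • Matrix.diagonal a) * Uᵀ = y • M := by
      rw [hM]; simp
    rw [Matrix.mul_add, Matrix.add_mul, e2, e1, Matrix.mul_sub, Matrix.sub_mul, Matrix.mul_one,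
      hU', e3, downdate, smul_sub, smul_smul, div_eq_mul_inv]
    abel
  show eval y _ = eval y _
  rw [eval_C_mul, eval_charpolyRev_eq_det, hmat, det_orthogonal_conj hU,
    det_diagonal_add_vecMulVec hne, mul_add, eval_finsetSum, hii, Finset.sum_mul, ← hii,
    Finset.mul_sum, ← Finset.sum_add_distrib]
  -- Termwise, the two contributions combine through `(1 - a l * y) + a l * y = 1`.
  refine Finset.sum_congr rfl fun l _ => ?_
  rw [eval_C_mul, eval_prod, ← Finset.mul_prod_erase Finset.univ _ (Finset.mem_univ l)]
  simp only [Pi.smul_apply, smul_eq_mul, eval_sub, eval_one, eval_mul, eval_C, eval_X, hw]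
  field_simp
  ring

/-- Summing over `i` removes the `U i l ^ 2`, since the columns of `U` are unit vectors; what is
left is the product rule. -/
theorem sum_diag_mul_charpolyRev_downdate {M : Matrix ι ι ℝ} (hM : M.PosSemidef) :
    ∑ i, C (M i i) * (downdate M i).charpolyRev = -derivative M.charpolyRev := by
  obtain ⟨U, hU, hMU⟩ := exists_orthogonal_diagonalization hM.1
  rw [charpolyRev_of_diagonalization hU hMU, derivative_prod_finset,
    Finset.sum_congr rfl fun i _ => diag_mul_charpolyRev_downdate hU hMU hM.eigenvalues_nonneg i,
    Finset.sum_comm, ← Finset.sum_neg_distrib]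
  refine Finset.sum_congr rfl fun l _ => ?_
  rw [← Finset.sum_mul, ← map_sum, ← Finset.mul_sum]
  have : ∑ i, U i l ^ 2 = 1 := by
    have := congrFun (congrFun hU l) l
    rw [Matrix.mul_apply, Matrix.one_apply_eq] at this
    rw [← this]
    exact Finset.sum_congr rfl fun i _ => by rw [Matrix.transpose_apply, sq]
  rw [this, mul_one, derivative_sub, derivative_one, derivative_C_mul, derivative_X]
  ring

/-- If the `(m + 1)`-st derivative of the reverse characteristic polynomial of `M` has constant sign
to the left of `ρ`, then some downdate of `M` has this property for the `m`-th derivative. -/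
theorem exists_downdate {M : Matrix ι ι ℝ} (hM : M.PosSemidef) (m : ℕ) {ρ : ℝ}
    (h : ∀ y < ρ, 0 < (-1) ^ (m + 1) * (derivative^[m + 1] M.charpolyRev).eval y) :
    ∃ i, 0 < M i i ∧
      ∀ y < ρ, 0 < (-1) ^ m * (derivative^[m] (downdate M i).charpolyRev).eval y := by
  obtain ⟨U, hU, hMU⟩ := exists_orthogonal_diagonalization hM.1
  set a := hM.1.eigenvalues
  have ha : ∀ l, 0 ≤ a l := hM.eigenvalues_nonneg
  have hg := charpolyRev_of_diagonalization hU hMU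
  have hsq : ((-1 : ℝ) ^ m) * (-1) ^ m = 1 := by rw [← mul_pow]; simp
  -- The sign `(-1) ^ m` makes everything nonnegative on the negative half-line. Interlacing is
  -- known after multiplication by `M i i`, which cancels for positive weights.
  have key := exists_eval_pos_of_wronskian (h := C ((-1) ^ m) * derivative^[m] M.charpolyRev)
    (q := fun i => C ((-1) ^ m) * derivative^[m] (downdate M i).charpolyRev)
    (w := fun i => M i i) (ρ := ρ)
    (fun i => hM.diag_nonneg) ?_ ?_ ?_ ?_ ?_
  · simpa using key
  · intro x
    have e := congrArg (fun p => eval x (derivative^[m] p)) (sum_diag_mul_charpolyRev_downdate hM)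
    simp only [iterate_derivative_sum, iterate_derivative_C_mul, eval_finsetSum, eval_C_mul,
      iterate_derivative_neg, eval_neg, ← Function.iterate_succ_apply] at e
    rw [derivative_C_mul, ← Function.iterate_succ_apply' derivative]
    simp only [eval_C_mul]
    rw [← neg_eq_iff_eq_neg.mpr e, ← Finset.sum_neg_distrib, Finset.mul_sum,
      ← Finset.sum_neg_distrib]
    exact Finset.sum_congr rfl fun i _ => by ring
  · intro i hi x
    have := (sum_prod_erase_properties a (fun l => a l * U i l ^ 2) ha
      (fun l => mul_nonneg (ha l) (sq_nonneg _)) m).1 x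
    rw [← diag_mul_charpolyRev_downdate hU hMU ha i, ← hg, iterate_derivative_C_mul,
      iterate_derivative_C_mul, eval_C_mul, eval_C_mul] at this
    simp only [derivative_C_mul, ← Function.iterate_succ_apply' derivative, eval_C_mul]
    refine (mul_nonneg_iff_of_pos_left hi).mp (le_of_le_of_eq this ?_)
    simp only [Nat.succ_eq_add_one]
    linear_combination (-(M i i) *
      (eval x (derivative^[m + 1] (downdate M i).charpolyRev) * eval x (derivative^[m] M.charpolyRev)
      - eval x (derivative^[m] (downdate M i).charpolyRev) *
        eval x (derivative^[m + 1] M.charpolyRev))) * hsq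
  · intro x hx
    rw [hg, eval_C_mul]
    exact iterate_derivative_prod_sign _ a (fun l _ => ha l) m hx
  · intro i hi x hx
    have := (sum_prod_erase_properties a (fun l => a l * U i l ^ 2) ha
      (fun l => mul_nonneg (ha l) (sq_nonneg _)) m).2 x hx
    rw [← diag_mul_charpolyRev_downdate hU hMU ha i, iterate_derivative_C_mul, eval_C_mul] at this
    rw [eval_C_mul]
    refine (mul_nonneg_iff_of_pos_left hi).mp (le_of_le_of_eq this ?_)
    ring
  · intro x hx
    have := h x hx
    rw [derivative_C_mul, eval_C_mul, ← Function.iterate_succ_apply' derivative]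
    rw [pow_succ] at this
    linarith

end Downdate

/-! ### Residual projections and greedy choice of columns -/

section Residual

open Polynomial

variable {n d : ℕ}

/-- `Q` is the orthogonal projection onto the complement of the span of the columns of `A` with
index in `S`, and these columns are linearly independent. -/
structure IsResidualProjection (A : Matrix (Fin n) (Fin d) ℝ) (S : Finset (Fin d))
    (Q : Matrix (Fin n) (Fin n) ℝ) : Prop where
  isSymm : Qᵀ = Q
  idem : Q * Q = Q
  mul_col : ∀ j ∈ S, Q *ᵥ A.col j = 0
  one_sub : ∃ Y : Matrix (Fin d) (Fin n) ℝ, 1 - Q = A * Y ∧ ∀ j ∉ S, Y.row j = 0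
  trace : (1 - Q).trace = S.card

theorem isResidualProjection_empty (A : Matrix (Fin n) (Fin d) ℝ) :
    IsResidualProjection A ∅ 1 where
  isSymm := Matrix.transpose_one
  idem := Matrix.one_mul 1
  mul_col := by simp
  one_sub := ⟨0, by simp, fun j _ => rfl⟩
  trace := by simp

theorem IsResidualProjection.gram {A : Matrix (Fin n) (Fin d) ℝ} {S : Finset (Fin d)}
    {Q : Matrix (Fin n) (Fin n) ℝ} (h : IsResidualProjection A S Q) :
    Aᵀ * Q * A = (Q * A)ᵀ * (Q * A) := by
  rw [Matrix.transpose_mul, h.isSymm, Matrix.mul_assoc Aᵀ Q (Q * A), ← Matrix.mul_assoc Q Q A, h.idem,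
    Matrix.mul_assoc]

theorem IsResidualProjection.posSemidef {A : Matrix (Fin n) (Fin d) ℝ} {S : Finset (Fin d)}
    {Q : Matrix (Fin n) (Fin n) ℝ} (h : IsResidualProjection A S Q) :
    (Aᵀ * Q * A).PosSemidef := by
  rw [h.gram]
  simpa using Matrix.posSemidef_conjTranspose_mul_self (Q * A)

/-- A Gram–Schmidt step: `r = Q a_i` has squared length `c > 0`, and subtracting the projection `c⁻¹
r rᵀ` from `Q` takes the Schur complement of `AᵀQA`. Positivity of `c` also forces `i ∉ S`. -/
theorem IsResidualProjection.insert {A : Matrix (Fin n) (Fin d) ℝ} {S : Finset (Fin d)}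
    {Q : Matrix (Fin n) (Fin n) ℝ} (h : IsResidualProjection A S Q) {i : Fin d}
    (hi : 0 < (Aᵀ * Q * A) i i) :
    ∃ Q', IsResidualProjection A (insert i S) Q' ∧ i ∉ S ∧
      Aᵀ * Q' * A = downdate (Aᵀ * Q * A) i := by
  set c := (Aᵀ * Q * A) i i with hc
  set r := Q *ᵥ A.col i with hr
  have hQr : Q *ᵥ r = r := by rw [hr, Matrix.mulVec_mulVec, h.idem]
  have hrQ : r ᵥ* Q = r := by
    rw [← h.isSymm, Matrix.vecMul_transpose, hQr]
  have hcol : ∀ j, (Aᵀ * Q * A).col j = Aᵀ *ᵥ (Q *ᵥ A.col j) := by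
    intro j
    rw [Matrix.mulVec_mulVec]
    ext k
    rw [Matrix.col_apply, Matrix.mul_apply, Matrix.mulVec, dotProduct]
    rfl
  have hra : ∀ j, r ⬝ᵥ A.col j = (Aᵀ * Q * A) j i := by
    intro j
    have := congrFun (hcol i) j
    rw [Matrix.col_apply] at this
    rw [this, dotProduct_comm]
    rfl
  have hrr : r ⬝ᵥ r = c := by
    have : r ⬝ᵥ r = (r ᵥ* Q) ⬝ᵥ A.col i := by rw [← Matrix.dotProduct_mulVec]
    rw [this, hrQ, hra, hc]
  have hiS : i ∉ S := by
    intro hiS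
    have : r = 0 := h.mul_col i hiS
    rw [this] at hrr
    simp at hrr
    exact hi.ne hrr
  refine ⟨Q - c⁻¹ • Matrix.vecMulVec r r, ⟨?_, ?_, ?_, ?_, ?_⟩, hiS, ?_⟩
  · rw [Matrix.transpose_sub, h.isSymm, Matrix.transpose_smul, Matrix.transpose_vecMulVec]
  · rw [Matrix.sub_mul, Matrix.mul_sub, Matrix.mul_sub, h.idem, Matrix.mul_smul,
      Matrix.mul_vecMulVec, hQr, Matrix.smul_mul, Matrix.vecMulVec_mul, hrQ, Matrix.smul_mul,
      Matrix.mul_smul, Matrix.vecMulVec_mul_vecMulVec, hrr, smul_smul]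
    simp [Matrix.vecMulVec_smul, smul_smul, hi.ne']
  · intro j hj
    rw [Matrix.sub_mulVec, Matrix.smul_mulVec, Matrix.vecMulVec_mulVec, hra]
    rcases Finset.mem_insert.mp hj with hj | hj
    · subst hj
      rw [← hc, ← hr]
      simp [smul_smul, inv_mul_cancel₀ hi.ne']
    · have h1 := h.mul_col j hj
      have h2 : (Aᵀ * Q * A) j i = 0 := by
        have h3 : (Aᵀ * Q * A) i j = 0 := by
          have := congrFun (hcol j) i
          rw [h1] at this
          simpa using this
        have h4 := congrFun (congrFun h.posSemidef.1 i) j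
        rw [Matrix.conjTranspose_apply, star_trivial, h3] at h4
        exact h4
      rw [h1, h2]
      simp
  · obtain ⟨Y, hY, hYS⟩ := h.one_sub
    have hrA : r = A *ᵥ (Pi.single i 1 - Y *ᵥ A.col i) := by
      rw [Matrix.mulVec_sub, Matrix.mulVec_mulVec, ← hY, Matrix.sub_mulVec, Matrix.one_mulVec,
        Matrix.mulVec_single_one]
      simp [hr]
    refine ⟨Y + c⁻¹ • Matrix.vecMulVec (Pi.single i 1 - Y *ᵥ A.col i) r, ?_, ?_⟩
    · rw [Matrix.mul_add, ← hY, Matrix.mul_smul, Matrix.mul_vecMulVec, ← hrA]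
      abel
    · intro j hj
      rw [Finset.mem_insert, not_or] at hj
      have h1 := hYS j hj.2
      have h2 : (Y *ᵥ A.col i) j = 0 := by
        rw [Matrix.mulVec]
        change Y.row j ⬝ᵥ _ = 0
        rw [h1, zero_dotProduct]
      ext k
      have h3 := congrFun h1 k
      simp only [Matrix.row_apply, Pi.zero_apply] at h3
      simp [Matrix.vecMulVec_apply, h2, h3, hj.1]
  · rw [Finset.card_insert_of_notMem hiS, sub_sub_eq_add_sub, add_sub_right_comm, Matrix.trace_add,
      h.trace, Matrix.trace_smul, Matrix.trace_vecMulVec, hrr]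
    simp [hi.ne']
  · rw [downdate, Matrix.mul_sub, Matrix.sub_mul, Matrix.mul_smul, Matrix.mul_vecMulVec,
      Matrix.smul_mul, Matrix.vecMulVec_mul, hcol, ← Matrix.mulVec_transpose]

/-- Each chosen column uses up one derivative; `S` and `Q` vary so that the induction can restart
after a choice. -/
theorem exists_isResidualProjection (A : Matrix (Fin n) (Fin d) ℝ) {ρ : ℝ} (k : ℕ) :
    ∀ (S : Finset (Fin d)) (Q : Matrix (Fin n) (Fin n) ℝ), IsResidualProjection A S Q →
      (∀ y < ρ, 0 < (-1) ^ k * (derivative^[k] (Aᵀ * Q * A).charpolyRev).eval y) →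
      ∃ S' Q', IsResidualProjection A S' Q' ∧ S'.card = S.card + k ∧
        ∀ y < ρ, 0 < (Aᵀ * Q' * A).charpolyRev.eval y := by
  induction k with
  | zero => exact fun S Q hQ h => ⟨S, Q, hQ, rfl, by simpa using h⟩
  | succ k ih =>
    intro S Q hQ h
    obtain ⟨i, hi, hpos⟩ := exists_downdate hQ.posSemidef k h
    obtain ⟨Q₁, hQ₁, hiS, he⟩ := hQ.insert hi
    rw [← he] at hpos
    obtain ⟨S', Q', h1, h2, h3⟩ := ih _ Q₁ hQ₁ hpos
    exact ⟨S', Q', h1, by rw [h2, Finset.card_insert_of_notMem hiS]; ring, h3⟩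

theorem IsResidualProjection.eq_columns_mul {A : Matrix (Fin n) (Fin d) ℝ} {S : Finset (Fin d)}
    {Q : Matrix (Fin n) (Fin n) ℝ} (h : IsResidualProjection A S Q) :
    ∃ Y : Matrix S (Fin n) ℝ, 1 - Q = columns A S * Y := by
  obtain ⟨Y, hY, hYS⟩ := h.one_sub
  refine ⟨Y.submatrix (fun j : S => (j : Fin d)) id, ?_⟩
  rw [hY]
  ext a b
  simp only [Matrix.mul_apply, columns, Matrix.submatrix_apply, id]
  rw [Finset.sum_coe_sort S (fun j => A a j * Y j b)]
  symm
  refine Finset.sum_subset (Finset.subset_univ S) fun j _ hj => ?_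
  have := congrFun (hYS j hj) b
  simp only [Matrix.row_apply, Pi.zero_apply] at this
  rw [this, mul_zero]

/-- Both sides are symmetric, and each fixes the range of the other, so they agree. -/
theorem IsResidualProjection.columns_mul_pinv {A : Matrix (Fin n) (Fin d) ℝ} {S : Finset (Fin d)}
    {Q : Matrix (Fin n) (Fin n) ℝ} (h : IsResidualProjection A S Q) :
    columns A S * pinv (columns A S) = 1 - Q := by
  obtain ⟨Y, hY⟩ := h.eq_columns_mul
  set B := columns A S
  have hQB : Q * B = 0 := by
    ext a j
    have := congrFun (h.mul_col j j.2) a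
    rw [Matrix.mul_apply]
    exact this
  have hp := pinv_isMoorePenrose B
  have h1 : B * pinv B * (1 - Q) = 1 - Q := by
    rw [hY, ← Matrix.mul_assoc, hp.mul_mul_self]
  have h2 : (1 - Q) * (B * pinv B) = B * pinv B := by
    rw [← Matrix.mul_assoc, Matrix.sub_mul, hQB, Matrix.one_mul, sub_zero]
  have h3 : (1 - Q)ᵀ = 1 - Q := by rw [Matrix.transpose_sub, Matrix.transpose_one, h.isSymm]
  calc B * pinv B = (B * pinv B)ᵀ := hp.isSymm_left.symm
    _ = ((1 - Q) * (B * pinv B))ᵀ := by rw [h2]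
    _ = B * pinv B * (1 - Q) := by rw [Matrix.transpose_mul, hp.isSymm_left, h3]
    _ = 1 - Q := h1

theorem IsResidualProjection.rank_columns {A : Matrix (Fin n) (Fin d) ℝ} {S : Finset (Fin d)}
    {Q : Matrix (Fin n) (Fin n) ℝ} (h : IsResidualProjection A S Q) :
    (columns A S).rank = S.card := by
  refine le_antisymm ?_ ?_
  · simpa using (columns A S).rank_le_card_width
  · obtain ⟨Y, hY⟩ := h.eq_columns_mul
    -- The rank of an idempotent is its trace, here `S.card`.
    have hidem : IsIdempotentElem (Matrix.toLin' (1 - Q)) := by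
      rw [IsIdempotentElem, Module.End.mul_eq_comp, ← Matrix.toLin'_mul]
      congr 1
      rw [Matrix.mul_sub, Matrix.mul_one, Matrix.sub_mul, Matrix.one_mul, h.idem, sub_self,
        sub_zero]
    have htr := (LinearMap.IsIdempotentElem.isProj_range _ hidem).trace
    rw [Matrix.trace_toLin'_eq, h.trace] at htr
    have : S.card = (1 - Q).rank := by
      exact_mod_cast htr
    rw [this, hY]
    exact Matrix.rank_mul_le_left _ _

end Residual

/-! ### Lower bound for the roots of the `k`-th derivative -/

section SmallestRoot

open Polynomial

theorem natDegree_prod_one_sub {ι : Type*} (s : Finset ι) {μ : ι → ℝ} (hμ : ∀ i ∈ s, μ i ≠ 0) :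
    (∏ i ∈ s, (1 - C (μ i) * X) : ℝ[X]).natDegree = s.card := by
  have h1 : ∀ i ∈ s, (1 - C (μ i) * X : ℝ[X]).natDegree = 1 := by
    intro i hi
    have := hμ i hi
    compute_degree!
  rw [natDegree_prod _ _ fun i hi h0 => ?_, Finset.sum_congr rfl h1]
  · simp
  · have := h1 i hi
    rw [h0] at this
    simp at this

/-- The barrier estimate for a polynomial with roots `(μ i)⁻¹` in `[a, b]` of given mean, for the
barrier point `a - s`. -/
theorem iterate_derivative_prod_pos_of_le {ι : Type*} (S : Finset ι) {μ : ι → ℝ} {a b β s : ℝ}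
    {k : ℕ} (hμ : ∀ i ∈ S, 0 < μ i) (ha : ∀ i ∈ S, a ≤ (μ i)⁻¹) (hb : ∀ i ∈ S, (μ i)⁻¹ ≤ b)
    (hab : a < b) (hβ : 0 < β) (hmean : ∑ i ∈ S, (μ i)⁻¹ = S.card * (β * a + (1 - β) * b))
    (hk : k < S.card) (hs : 0 < s) :
    ∀ z ≤ a - s + k / S.card * (s * (s + (b - a)) / (s + β * (b - a))),
      0 < (-1) ^ k * (derivative^[k] (∏ i ∈ S, (1 - C (μ i) * X))).eval z := by
  classical
  have hL : 0 < b - a := sub_pos.mpr hab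
  have ht : (0 : ℝ) < S.card := by exact_mod_cast (Nat.zero_le k).trans_lt hk
  have hfac : ∀ z ≤ a - s, ∀ i ∈ S, 0 < 1 - μ i * z := by
    intro z hz i hi
    have h1 : z < (μ i)⁻¹ := by linarith [ha i hi]
    have h2 := mul_lt_mul_of_pos_left h1 (hμ i hi)
    rw [mul_inv_cancel₀ (hμ i hi).ne'] at h2
    linarith
  have hpos : ∀ z ≤ a - s, 0 < (∏ i ∈ S, (1 - C (μ i) * X) : ℝ[X]).eval z := by
    intro z hz
    rw [eval_prod]
    refine Finset.prod_pos fun i hi => ?_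
    simpa using hfac z hz i hi
  set φ : ℝ := S.card * (s + β * (b - a)) / (s * (s + (b - a))) with hφ
  have hv : 0 < s + β * (b - a) := by positivity
  have hbar : -(derivative (∏ i ∈ S, (1 - C (μ i) * X) : ℝ[X])).eval (a - s) ≤
      φ * (∏ i ∈ S, (1 - C (μ i) * X) : ℝ[X]).eval (a - s) := by
    have h1 : -(derivative (∏ i ∈ S, (1 - C (μ i) * X) : ℝ[X])).eval (a - s) =
        (∑ i ∈ S, ((μ i)⁻¹ - (a - s))⁻¹) * (∏ i ∈ S, (1 - C (μ i) * X) : ℝ[X]).eval (a - s) := by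
      rw [derivative_prod_finset, eval_finsetSum, ← Finset.sum_neg_distrib, Finset.sum_mul]
      refine Finset.sum_congr rfl fun i hi => ?_
      rw [← Finset.mul_prod_erase S _ hi]
      have h2 := (hμ i hi).ne'
      have h3 := (hfac _ le_rfl i hi).ne'
      have h4 : ((μ i)⁻¹ - (a - s))⁻¹ = μ i / (1 - μ i * (a - s)) := by
        rw [inv_eq_iff_eq_inv, inv_div, sub_div, mul_div_cancel_left₀ _ h2, one_div]
      rw [h4]
      simp only [eval_mul, derivative_sub, derivative_one, derivative_C_mul, derivative_X, zero_sub,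
        mul_one, eval_neg, eval_C, eval_sub, eval_one, eval_X]
      rw [← mul_assoc, div_mul_cancel₀ _ h3]
      ring
    rw [h1]
    refine mul_le_mul_of_nonneg_right ?_ (hpos _ le_rfl).le
    -- The convex function `x ↦ 1 / (x - (a - s))` lies below its chord over `[a, b]`. The chord is
    -- affine, so its sum depends only on the mean of the roots and equals `φ`.
    have h2 : ∀ i ∈ S, ((μ i)⁻¹ - (a - s))⁻¹ ≤ (b + s - (μ i)⁻¹) / (s * (s + (b - a))) := by
      intro i hi
      have h3 := ha i hi
      have h4 := hb i hi
      have h5 : 0 < (μ i)⁻¹ - (a - s) := by linarith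
      rw [inv_eq_one_div, div_le_div_iff₀ h5 (by positivity)]
      nlinarith [mul_nonneg (sub_nonneg.mpr h3) (sub_nonneg.mpr h4)]
    refine (Finset.sum_le_sum h2).trans (le_of_eq ?_)
    rw [← Finset.sum_div, Finset.sum_sub_distrib, hmean, Finset.sum_const, nsmul_eq_mul, hφ]
    congr 1
    ring
  have key := barrier_iterate_derivative (splits_prod_one_sub S μ) k
    (by rw [natDegree_prod_one_sub S fun i hi => (hμ i hi).ne']; omega) hpos hbar
  intro z hz
  refine key z (hz.trans (le_of_eq ?_))
  rw [hφ]
  field_simp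

theorem iterate_derivative_prod_pos {ι : Type*} (S : Finset ι) {μ : ι → ℝ} {a b β : ℝ}
    {k : ℕ} (hμ : ∀ i ∈ S, 0 < μ i) (ha : ∀ i ∈ S, a ≤ (μ i)⁻¹) (hb : ∀ i ∈ S, (μ i)⁻¹ ≤ b)
    (hab : a < b) (hβ : 0 < β) (hβ1 : β < 1)
    (hmean : ∑ i ∈ S, (μ i)⁻¹ = S.card * (β * a + (1 - β) * b))
    (hk : k < S.card) (hβk : β * S.card ≤ k) :
    ∀ z < a + (1 - β) * (b - a) *
        (√((k : ℝ) / S.card) - √(β / (1 - β) * (1 - (k : ℝ) / S.card))) ^ 2,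
      0 < (-1) ^ k * (derivative^[k] (∏ i ∈ S, (1 - C (μ i) * X))).eval z := by
  intro z hz
  have main := fun {s : ℝ} (hs : 0 < s) =>
    iterate_derivative_prod_pos_of_le S hμ ha hb hab hβ hmean hk hs z
  have ht : (0 : ℝ) < S.card := by exact_mod_cast (Nat.zero_le k).trans_lt hk
  have hL : 0 < b - a := sub_pos.mpr hab
  have hκ1 : (k : ℝ) / S.card < 1 := by
    rw [div_lt_one ht]; exact_mod_cast hk
  have hκβ : β ≤ (k : ℝ) / S.card := by rwa [le_div_iff₀ ht]
  set κ : ℝ := (k : ℝ) / S.card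
  set L := b - a
  clear_value κ L
  have h1β : 0 < 1 - β := by linarith
  have h1κ : 0 < 1 - κ := by linarith
  set p := √(κ * (1 - β)) with hp
  set q := √(β * (1 - κ)) with hq
  have hp2 : p ^ 2 = κ * (1 - β) := Real.sq_sqrt (by nlinarith)
  have hq2 : q ^ 2 = β * (1 - κ) := Real.sq_sqrt (by positivity)
  have hp0 : 0 < p := Real.sqrt_pos.mpr (by nlinarith)
  have hq0 : 0 < q := Real.sqrt_pos.mpr (by positivity)
  have hγ : (1 - β) * L * (√κ - √(β / (1 - β) * (1 - κ))) ^ 2 = L * (p - q) ^ 2 := by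
    have e1 : p = √κ * √(1 - β) := Real.sqrt_mul (hβ.le.trans hκβ) _
    have e2 : q = √(β / (1 - β) * (1 - κ)) * √(1 - β) := by
      rw [← Real.sqrt_mul (by positivity), hq]
      congr 1
      field_simp
    rw [e1, e2, ← sub_mul, mul_pow, Real.sq_sqrt h1β.le]
    ring
  rw [hγ] at hz
  rcases hκβ.lt_or_eq with hlt | heq
  · have hqp : q < p := Real.sqrt_lt_sqrt (by positivity) (by nlinarith)
    have hpq : 0 < p - q := sub_pos.mpr hqp
    -- The maximiser of the bound: in terms of `v = s + β L` it is a constant minus `(1 - κ) v + κ β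
    -- (1 - β) L² / v`, hence `v = L p q / (1 - κ)`.
    have hs : 0 < L * q * (p - q) / (1 - κ) := by positivity
    refine main hs (hz.le.trans (le_of_eq ?_))
    have hv : L * q * (p - q) / (1 - κ) + β * L = L * p * q / (1 - κ) := by
      field_simp
      linear_combination -hq2
    rw [hv]
    have hκ' : κ * (1 - β) * (1 - κ) = -κ * q ^ 2 + κ * (1 - κ) := by rw [hq2]; ring
    field_simp
    linear_combination L * (p - q) * hκ' + L * (p - q) * (1 - κ) * hp2
  · have hpq : p = q := by rw [hp, hq, ← heq]
    rw [hpq, sub_self, zero_pow two_ne_zero, mul_zero, add_zero] at hz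
    -- For `κ = β` the optimal `s` degenerates to `0`, so `s = a - z` is adapted to the given `z <
    -- a`.
    have hs : 0 < a - z := sub_pos.mpr hz
    refine main hs ?_
    rw [sub_sub_cancel]
    have : 0 ≤ κ * ((a - z) * (a - z + L) / (a - z + β * L)) :=
      mul_nonneg (hβ.le.trans hκβ) (by positivity)
    linarith

end SmallestRoot

/-! ### Spectral norm and eigenvalues of the Gram matrix -/

section Spectral

open Polynomial

theorem norm_eq_norm_eigenvalues {ι : Type*} [Fintype ι] [DecidableEq ι] {M : Matrix ι ι ℝ}
    (hM : M.IsHermitian) : ‖M‖ = ‖hM.eigenvalues‖ := by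
  conv_lhs => rw [hM.spectral_theorem, Unitary.conjStarAlgAut_apply]
  rw [← Unitary.coe_star, CStarRing.norm_mul_coe_unitary, CStarRing.norm_coe_unitary_mul,
    Matrix.l2_opNorm_diagonal]
  rfl

theorem sq_norm_eq_norm_gram {m n : ℕ} (A : Matrix (Fin m) (Fin n) ℝ) : ‖A‖ ^ 2 = ‖Aᵀ * A‖ := by
  rw [sq, ← Matrix.l2_opNorm_conjTranspose_mul_self, Matrix.conjTranspose_eq_transpose_of_trivial]

/-- An eigenvalue above `1 / ρ` would have its reciprocal as a root below `ρ`. -/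
theorem norm_le_of_charpolyRev_pos {ι : Type*} [Fintype ι] [DecidableEq ι] {M : Matrix ι ι ℝ}
    (hM : M.PosSemidef) {ρ : ℝ} (hρ : 0 < ρ) (h : ∀ y < ρ, 0 < M.charpolyRev.eval y) :
    ‖M‖ ≤ 1 / ρ := by
  rw [norm_eq_norm_eigenvalues hM.1]
  refine (pi_norm_le_iff_of_nonneg (by positivity)).mpr fun l => ?_
  rw [Real.norm_of_nonneg (hM.eigenvalues_nonneg l)]
  by_contra! hl
  obtain ⟨U, hU, hMU⟩ := exists_orthogonal_diagonalization hM.1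
  have hpos : 0 < hM.1.eigenvalues l := (by positivity : 0 < 1 / ρ).trans hl
  have := h (hM.1.eigenvalues l)⁻¹ (by rw [one_div] at hl; exact inv_lt_of_inv_lt₀ hρ hl)
  rw [charpolyRev_of_diagonalization hU hMU, eval_prod,
    Finset.prod_eq_zero (Finset.mem_univ l)] at this
  · exact this.false
  · simp [mul_inv_cancel₀ hpos.ne']

variable {n d : ℕ}

theorem gramEigenvalue_succ (A : Matrix (Fin n) (Fin d) ℝ) {j : ℕ}
    (hj : j < Fintype.card (Fin d)) :
    gramEigenvalue A (j + 1) = (isHermitian_gram A).eigenvalues₀ ⟨j, hj⟩ := by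
  simp only [gramEigenvalue, Nat.add_sub_cancel, dif_pos hj]

theorem posSemidef_gram (A : Matrix (Fin n) (Fin d) ℝ) : (Aᵀ * A).PosSemidef := by
  simpa using Matrix.posSemidef_conjTranspose_mul_self A

/-- The eigenvalues of `Aᵀ * A`, indexed by the columns, are the `gramEigenvalue A (j + 1)`,
`j < d`. -/
theorem exists_equiv_eigenvalues (A : Matrix (Fin n) (Fin d) ℝ) :
    ∃ e : Fin d ≃ Fin d, ∀ l,
      (isHermitian_gram A).eigenvalues l = gramEigenvalue A ((e l : ℕ) + 1) := by
  refine ⟨(Fintype.equivOfCardEq (Fintype.card_fin _)).symm.trans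
    (finCongr (Fintype.card_fin d)), fun l => ?_⟩
  rw [gramEigenvalue_succ A ((Fin.isLt _).trans_eq (Fintype.card_fin d).symm)]
  rfl

theorem gramEigenvalue_nonneg (A : Matrix (Fin n) (Fin d) ℝ) (i : ℕ) : 0 ≤ gramEigenvalue A i := by
  unfold gramEigenvalue
  split_ifs with h
  · obtain ⟨l, hl⟩ := (Fintype.equivOfCardEq (Fintype.card_fin _) :
      Fin (Fintype.card (Fin d)) ≃ Fin d).symm.surjective ⟨i - 1, h⟩
    have := (posSemidef_gram A).eigenvalues_nonneg l
    rw [← hl]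
    exact this
  · exact le_rfl

theorem gramEigenvalue_antitone (A : Matrix (Fin n) (Fin d) ℝ) : Antitone (gramEigenvalue A) := by
  intro i j hij
  by_cases hj : j - 1 < Fintype.card (Fin d)
  · have hi : i - 1 < Fintype.card (Fin d) := by omega
    simp only [gramEigenvalue, dif_pos hi, dif_pos hj]
    exact (isHermitian_gram A).eigenvalues₀_antitone (Fin.mk_le_mk.mpr (by omega))
  -- Beyond index `d` the default value `0` keeps the sequence non-increasing.
  · have : gramEigenvalue A j = 0 := dif_neg hj
    rw [this]
    exact gramEigenvalue_nonneg A i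

/-- The nonzero eigenvalues number `A.rank`, and by monotonicity they form an initial segment. -/
theorem filter_gramEigenvalue_ne_zero (A : Matrix (Fin n) (Fin d) ℝ) :
    (Finset.range d).filter (fun j => gramEigenvalue A (j + 1) ≠ 0) = Finset.range A.rank := by
  obtain ⟨e, he⟩ := exists_equiv_eigenvalues A
  have hcard : ((Finset.range d).filter fun j => gramEigenvalue A (j + 1) ≠ 0).card = A.rank := by
    rw [← Matrix.rank_transpose_mul_self, (isHermitian_gram A).rank_eq_card_non_zero_eigs,
      Fintype.card_subtype, Finset.card_filter, Finset.card_filter]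
    simp only [he]
    rw [Equiv.sum_comp e fun j : Fin d => if gramEigenvalue A ((j : ℕ) + 1) ≠ 0 then 1 else 0,
      Fin.sum_univ_eq_sum_range (fun j => if gramEigenvalue A (j + 1) ≠ 0 then 1 else 0) d]
  refine Finset.eq_of_subset_of_card_le (fun j hj => ?_) (by rw [hcard, Finset.card_range])
  rw [Finset.mem_filter, Finset.mem_range] at hj
  rw [Finset.mem_range, ← hcard, ← Nat.succ_le_iff, ← Finset.card_range (Nat.succ j)]
  refine Finset.card_le_card fun i hi => ?_
  rw [Finset.mem_range, Nat.lt_succ_iff] at hi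
  rw [Finset.mem_filter, Finset.mem_range]
  refine ⟨hi.trans_lt hj.1, ?_⟩
  have h1 := gramEigenvalue_antitone A (Nat.succ_le_succ hi)
  have h2 := (gramEigenvalue_nonneg A (j + 1)).lt_of_ne' hj.2
  exact (h2.trans_le h1).ne'

/-- Zero eigenvalues contribute the factor `1`, so only the first `A.rank` remain. -/
theorem charpolyRev_gram (A : Matrix (Fin n) (Fin d) ℝ) :
    (Aᵀ * A).charpolyRev =
      ∏ j ∈ Finset.range A.rank, (1 - C (gramEigenvalue A (j + 1)) * X) := by
  obtain ⟨U, hU, hM⟩ := exists_orthogonal_diagonalization (isHermitian_gram A)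
  obtain ⟨e, he⟩ := exists_equiv_eigenvalues A
  rw [charpolyRev_of_diagonalization hU hM]
  simp only [he]
  rw [Equiv.prod_comp e fun j : Fin d => (1 - C (gramEigenvalue A ((j : ℕ) + 1)) * X : ℝ[X]),
    Fin.prod_univ_eq_prod_range (fun j => (1 - C (gramEigenvalue A (j + 1)) * X : ℝ[X])) d,
    ← filter_gramEigenvalue_ne_zero, Finset.prod_filter_of_ne]
  intro j _ hj h0
  rw [h0] at hj
  simp at hj

theorem norm_sq_eq_gramEigenvalue_one (A : Matrix (Fin n) (Fin d) ℝ) :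
    ‖A‖ ^ 2 = gramEigenvalue A 1 := by
  obtain ⟨e, he⟩ := exists_equiv_eigenvalues A
  rw [sq_norm_eq_norm_gram, norm_eq_norm_eigenvalues (isHermitian_gram A)]
  refine le_antisymm ?_ ?_
  · refine (pi_norm_le_iff_of_nonneg (gramEigenvalue_nonneg A 1)).mpr fun l => ?_
    rw [he, Real.norm_of_nonneg (gramEigenvalue_nonneg A _)]
    exact gramEigenvalue_antitone A (by omega)
  · rcases Nat.eq_zero_or_pos d with hd | hd
    · have : gramEigenvalue A 1 = 0 := dif_neg (by simp [hd])
      rw [this]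
      exact norm_nonneg _
    · have h1 := norm_le_pi_norm (isHermitian_gram A).eigenvalues (e.symm ⟨0, hd⟩)
      rw [he, Equiv.apply_symm_apply] at h1
      exact (le_abs_self _).trans h1

end Spectral

end ColumnSubset

/-! ### The column subset theorem -/

theorem theorem1p1 (n d t : ℕ) (A : Matrix (Fin n) (Fin d) ℝ) (hrank : A.rank = t)
    (hlt : ColumnSubset.gramEigenvalue A t < ColumnSubset.gramEigenvalue A 1)
    (α β : ℝ)
    (hα : α⁻¹ = (1 / (t : ℝ)) * ∑ i ∈ Finset.Icc 1 t, (ColumnSubset.gramEigenvalue A i)⁻¹)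
    (hβ : β = ((ColumnSubset.gramEigenvalue A t)⁻¹ - α⁻¹) /
      ((ColumnSubset.gramEigenvalue A t)⁻¹ - (ColumnSubset.gramEigenvalue A 1)⁻¹)) :
    (0 < β ∧ β < 1) ∧
    ∀ (k : ℕ) (γ : ℝ),
      γ = (√((k : ℝ) / t) - √(β / (1 - β) * (1 - (k : ℝ) / t))) ^ 2 →
      β * t ≤ k → k < t →
      (0 ≤ γ ∧ γ < 1) ∧
      ∃ S : Finset (Fin d), S.card = k ∧ (ColumnSubset.columns A S).rank = k ∧
        ‖A - ColumnSubset.columns A S * ColumnSubset.pinv (ColumnSubset.columns A S) * A‖ ^ 2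
          ≤ 1 / (1 + (‖A‖ ^ 2 * α⁻¹ - 1) * γ) * ‖A‖ ^ 2 := by
  open ColumnSubset in
  have ht2 : 2 ≤ t := by
    by_contra! h
    have := gramEigenvalue_antitone A (show t ≤ 1 by omega)
    linarith
  set μ : ℕ → ℝ := fun j => gramEigenvalue A (j + 1) with hμdef
  have hμt : gramEigenvalue A t = μ (t - 1) := by
    rw [hμdef]; simp only; congr 1; omega
  have hμ1 : gramEigenvalue A 1 = μ 0 := rfl
  have hanti : Antitone μ := fun i j hij => gramEigenvalue_antitone A (by omega)
  have hpos : ∀ j ∈ Finset.range t, 0 < μ j := by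
    intro j hj
    rw [← hrank, ← filter_gramEigenvalue_ne_zero, Finset.mem_filter] at hj
    exact (gramEigenvalue_nonneg A _).lt_of_ne' hj.2
  have hsum : ∑ i ∈ Finset.Icc 1 t, (gramEigenvalue A i)⁻¹ = ∑ j ∈ Finset.range t, (μ j)⁻¹ := by
    rw [Finset.range_eq_Ico, Finset.sum_Ico_add' (fun i => (gramEigenvalue A i)⁻¹) 0 t 1]
    rfl
  rw [hμt, hμ1] at hlt hβ
  rw [hsum] at hα
  set a := (μ 0)⁻¹ with ha
  set b := (μ (t - 1))⁻¹ with hb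
  have ht0 : (0 : ℝ) < t := by exact_mod_cast (by omega : 0 < t)
  have h0mem : 0 ∈ Finset.range t := Finset.mem_range.mpr (by omega)
  have htmem : t - 1 ∈ Finset.range t := Finset.mem_range.mpr (by omega)
  have hab : a < b := inv_strictAnti₀ (hpos _ htmem) hlt
  have ha0 : 0 < a := inv_pos.mpr (hpos 0 h0mem)
  have hal : ∀ j ∈ Finset.range t, a ≤ (μ j)⁻¹ := fun j hj =>
    inv_anti₀ (hpos j hj) (hanti (Nat.zero_le j))
  have hbl : ∀ j ∈ Finset.range t, (μ j)⁻¹ ≤ b := fun j hj =>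
    inv_anti₀ (hpos _ htmem) (hanti (by have := Finset.mem_range.mp hj; omega))
  have hmean : ∑ j ∈ Finset.range t, (μ j)⁻¹ = t * α⁻¹ := by
    rw [hα]; field_simp
  have hcard : ∀ c : ℝ, ∑ j ∈ Finset.range t, c = t * c := by simp
  have hma : a < α⁻¹ := by
    have := Finset.sum_lt_sum hal ⟨_, htmem, hab⟩
    rw [hcard, hmean] at this
    exact lt_of_mul_lt_mul_left this ht0.le
  have hmb : α⁻¹ < b := by
    have := Finset.sum_lt_sum hbl ⟨_, h0mem, hab⟩
    rw [hcard, hmean] at this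
    exact lt_of_mul_lt_mul_left this ht0.le
  have hL : 0 < b - a := sub_pos.mpr hab
  have hβ0 : 0 < β := by rw [hβ]; exact div_pos (by linarith) hL
  have hβ1 : β < 1 := by rw [hβ, div_lt_one hL]; linarith
  have hβL : β * (b - a) = b - α⁻¹ := by rw [hβ]; exact div_mul_cancel₀ _ hL.ne'
  refine ⟨⟨hβ0, hβ1⟩, fun k γ hγ hβk hkt => ?_⟩
  have h1β : 0 < 1 - β := by linarith
  have hγ0 : 0 ≤ γ := by rw [hγ]; positivity
  have hκ1 : (k : ℝ) / t < 1 := by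
    rw [div_lt_one ht0]; exact_mod_cast hkt
  have hκβ : β ≤ (k : ℝ) / t := by rwa [le_div_iff₀ ht0]
  have hγ1 : γ < 1 := by
    have h1 : √((k : ℝ) / t) < 1 := by
      rw [Real.sqrt_lt' one_pos]; simpa using hκ1
    -- This is where `β ≤ k / t` enters: the difference of the roots then lies in `[0, 1)`.
    have h2 : √(β / (1 - β) * (1 - (k : ℝ) / t)) ≤ √((k : ℝ) / t) := by
      refine Real.sqrt_le_sqrt ?_
      rw [div_mul_eq_mul_div, div_le_iff₀ h1β]
      nlinarith
    have h3 := Real.sqrt_nonneg (β / (1 - β) * (1 - (k : ℝ) / t))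
    rw [hγ, sq_lt_one_iff₀ (by linarith)]
    linarith
  refine ⟨⟨hγ0, hγ1⟩, ?_⟩
  have hroot := iterate_derivative_prod_pos (Finset.range t) hpos hal hbl hab hβ0 hβ1
    (by rw [hmean, Finset.card_range]; congr 1; linarith) (by rwa [Finset.card_range])
    (by rwa [Finset.card_range])
  rw [Finset.card_range, ← hγ, ← hrank, ← charpolyRev_gram] at hroot
  set ρ := a + (1 - β) * (b - a) * γ with hρ
  have hρ0 : 0 < ρ := by positivity
  obtain ⟨S, Q, hQ, hS, hchar⟩ := exists_isResidualProjection A k ∅ 1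
    (isResidualProjection_empty A) (by simpa using hroot)
  have hSk : S.card = k := by simpa using hS
  refine ⟨S, hSk, hQ.rank_columns.trans hSk, ?_⟩
  have hres : A - columns A S * pinv (columns A S) * A = Q * A := by
    rw [hQ.columns_mul_pinv, Matrix.sub_mul, Matrix.one_mul, sub_sub_cancel]
  rw [hres, sq_norm_eq_norm_gram (Q * A), ← hQ.gram, norm_sq_eq_gramEigenvalue_one A, hμ1]
  refine (norm_le_of_charpolyRev_pos hQ.posSemidef hρ0 hchar).trans (le_of_eq ?_)
  have hμ0 := hpos 0 h0mem
  -- Here `a = 1 / μ 0` and `(1 - β) (b - a) = α⁻¹ - a`, so `1 / ρ` is the claimed bound.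
  have hρ' : μ 0 * ρ = 1 + (μ 0 * α⁻¹ - 1) * γ := by
    have : μ 0 * a = 1 := mul_inv_cancel₀ hμ0.ne'
    rw [hρ]
    linear_combination (1 - γ) * this - μ 0 * γ * hβL
  rw [← hρ']
  field_simp
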